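/- Let $K$ be an algebraically closed field and let $g \ge 0$, $n \ge 1$ be integers. Let $\mathcal{M}_{g,n}$ be the moduli stack over $K$ of smooth $n$-pointed curves of genus $g$: its objects over a $K$-scheme $B$ are the smooth proper morphisms $C \to B$ of relative dimension $1$ with connected geometric fibers of genus $g$, together with $n$ pairwise disjoint sections. Let $\pi : \mathcal{M}_{g,n+1} \to \mathcal{M}_{g,n}$ be the morphism that drops the last section. Let $S$ be a variety over $K$ (an integral separated scheme of finite type over $K$), let $f : C \to S$ with sections $s_1, \dots, s_n : S \to C$ be a family of smooth $n$-pointed curves of genus $g$ over $S$, and let $u : S \to \mathcal{M}_{g,n}$ be the corresponding morphism. Then the following are equivalent. 1. There exist a $K$-scheme $S'$, a proper surjective morphism $p : S' \to S$ over $K$ and a morphism $u' : S' \to \mathcal{M}_{g,n+1}$ such that $\pi \circ u'$ and $u \circ p$ are $2$-isomorphic. 2. There exist a $K$-scheme $S'$, a finite surjective morphism $p : S' \to S$ over $K$ and a morphism $u' : S' \to \mathcal{M}_{g,n+1}$ such that $\pi \circ u'$ and $u \circ p$ are $2$-isomorphic. 3. There is a closed subscheme $T$ of $C$ of codimension $1$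 (the minimum of the codimensions of its irreducible components is $1$; in particular $T \neq \emptyset$) that is disjoint from $s_i(S)$ for every $i$. 4. There are a scheme $S'$ and a proper surjective morphism $p : S' \to S$ such that the base change $C \times_S S' \to S'$ has a section whose image is disjoint from the images of the base changes of $s_1, \dots, s_n$. -/

import Mathlib

open CategoryTheory Limits AlgebraicGeometry TopologicalSpace Opposite

universe u

noncomputable section

namespace PointedCurves

/-! ### Dimension of the cohomology of the structure sheaf of a scheme over a field -/

/-- The structure sheaf of `X` as a sheaf of abelian groups on the Zariski site of `X`. -/
def additiveSheaf (X : Scheme.{u}) :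
    Sheaf (Opens.grothendieckTopology X) AddCommGrpCat.{u} :=
  (sheafCompose _
    (forget₂ CommRingCat.{u} RingCat.{u} ⋙ forget₂ RingCat.{u} AddCommGrpCat.{u})).obj X.sheaf

/-- Multiplication by a global function, as an endomorphism of the structure sheaf. -/
def mulSheaf {X : Scheme.{u}} (a : Γ(X, ⊤)) : additiveSheaf X ⟶ additiveSheaf X :=
  ObjectProperty.homMk
    { app := fun U => AddCommGrpCat.ofHom
        (AddMonoidHom.mulLeft (X.presheaf.map (homOfLE (le_top : U.unop ≤ ⊤)).op a :
          Γ(X, U.unop)))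
      naturality := by
        intro U V i
        ext (x : Γ(X, U.unop))
        change X.presheaf.map (homOfLE (le_top : V.unop ≤ ⊤)).op a * X.presheaf.map i x =
          X.presheaf.map i (X.presheaf.map (homOfLE (le_top : U.unop ≤ ⊤)).op a * x)
        rw [map_mul]
        congr 1
        rw [← CommRingCat.comp_apply, ← Functor.map_comp]
        rfl }

lemma mulSheaf_one {X : Scheme.{u}} : mulSheaf (1 : Γ(X, ⊤)) = 𝟙 (additiveSheaf X) := by
  apply ObjectProperty.hom_ext
  ext U (x : Γ(X, U.unop))
  change X.presheaf.map (homOfLE (le_top : U.unop ≤ ⊤)).op 1 * x = x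
  rw [map_one, one_mul]

lemma mulSheaf_mul {X : Scheme.{u}} (a b : Γ(X, ⊤)) :
    mulSheaf (a * b) = mulSheaf b ≫ mulSheaf a := by
  apply ObjectProperty.hom_ext
  ext U (x : Γ(X, U.unop))
  change X.presheaf.map (homOfLE (le_top : U.unop ≤ ⊤)).op (a * b) * x =
    X.presheaf.map (homOfLE (le_top : U.unop ≤ ⊤)).op a *
      (X.presheaf.map (homOfLE (le_top : U.unop ≤ ⊤)).op b * x)
  rw [map_mul, mul_assoc]

lemma mulSheaf_add {X : Scheme.{u}} (a b : Γ(X, ⊤)) :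
    mulSheaf (a + b) = mulSheaf a + mulSheaf b := by
  apply ObjectProperty.hom_ext
  ext U (x : Γ(X, U.unop))
  change X.presheaf.map (homOfLE (le_top : U.unop ≤ ⊤)).op (a + b) * x =
    X.presheaf.map (homOfLE (le_top : U.unop ≤ ⊤)).op a * x +
      X.presheaf.map (homOfLE (le_top : U.unop ≤ ⊤)).op b * x
  rw [map_add, add_mul]

lemma H_map_mulSheaf_one {X : Scheme.{u}} {i : ℕ} (x : (additiveSheaf X).H i) :
    Sheaf.H.map (mulSheaf (1 : Γ(X, ⊤))) i x = x := by
  rw [mulSheaf_one, Sheaf.H.map_id_apply]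

lemma H_map_mulSheaf_mul {X : Scheme.{u}} {i : ℕ} (a b : Γ(X, ⊤))
    (x : (additiveSheaf X).H i) :
    Sheaf.H.map (mulSheaf (a * b)) i x =
      Sheaf.H.map (mulSheaf a) i (Sheaf.H.map (mulSheaf b) i x) := by
  rw [mulSheaf_mul, Sheaf.H.map_comp_apply]

lemma H_map_mulSheaf_add {X : Scheme.{u}} {i : ℕ} (a b : Γ(X, ⊤))
    (x : (additiveSheaf X).H i) :
    Sheaf.H.map (mulSheaf (a + b)) i x =
      Sheaf.H.map (mulSheaf a) i x + Sheaf.H.map (mulSheaf b) i x := by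
  rw [mulSheaf_add, Sheaf.H.map_add_apply]

lemma H_map_mulSheaf_zero {X : Scheme.{u}} {i : ℕ} (x : (additiveSheaf X).H i) :
    Sheaf.H.map (mulSheaf (0 : Γ(X, ⊤))) i x = 0 := by
  have h := H_map_mulSheaf_add 0 0 x
  rw [add_zero] at h
  exact left_eq_add.mp h

/-- The ring of global functions acts on `H^i(X, O_X)` through the endomorphisms of `O_X`. -/
def cohomologyAction (X : Scheme.{u}) (i : ℕ) :
    Γ(X, ⊤) →+* AddMonoid.End ((additiveSheaf X).H i) where
  toFun a := Sheaf.H.map (mulSheaf a) i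
  map_one' := AddMonoidHom.ext H_map_mulSheaf_one
  map_mul' a b := AddMonoidHom.ext (H_map_mulSheaf_mul a b)
  map_zero' := AddMonoidHom.ext H_map_mulSheaf_zero
  map_add' a b := AddMonoidHom.ext (H_map_mulSheaf_add a b)

/-- `dim_k H^i(X, O_X)` for a scheme `X` over a field `k`. -/
def cohomologyDim {k : Type u} [Field k] {X : Scheme.{u}} (π : X ⟶ Spec (.of k)) (i : ℕ) :
    Cardinal.{u} :=
  letI : Module k ((additiveSheaf X).H i) := Module.compHom _
    ((cohomologyAction X i).comp ((Scheme.ΓSpecIso (.of k)).inv ≫ π.appTop).hom)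
  Module.rank k ((additiveSheaf X).H i)

/-! ### Families of smooth pointed curves -/

/-- A family of smooth `n`-pointed curves of genus `g` over `S`: a smooth proper morphism of
relative dimension one, whose geometric fibers are connected of genus `g = dim H^1(O)`,
with `n` pairwise disjoint sections. -/
structure PointedCurve (g n : ℕ) (S : Scheme.{u}) where
  /-- the total space -/
  total : Scheme.{u}
  /-- the structure morphism -/
  proj : total ⟶ S
  /-- the marked points -/
  sec : Fin n → (S ⟶ total)
  sec_proj : ∀ i, sec i ≫ proj = 𝟙 S
  proper : IsProper proj
  smooth : SmoothOfRelativeDimension 1 proj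
  connected : GeometricallyConnected proj
  genus : ∀ (Ω : Type u) [Field Ω] [IsAlgClosed Ω] (s : Spec (.of Ω) ⟶ S) (Z : Scheme.{u})
    (a : Z ⟶ total) (b : Z ⟶ Spec (.of Ω)), IsPullback a b proj s → cohomologyDim b 1 = g
  disjoint : ∀ i j, i ≠ j → Disjoint (Set.range (sec i)) (Set.range (sec j))

namespace PointedCurve

variable {g n : ℕ}

lemma smooth_snd {X S T : Scheme.{u}} (f : X ⟶ S) (p : T ⟶ S)
    (h : SmoothOfRelativeDimension 1 f) : SmoothOfRelativeDimension 1 (pullback.snd f p) :=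
  haveI := smoothOfRelativeDimension_isStableUnderBaseChange.{u} 1
  MorphismProperty.of_isPullback (P := @SmoothOfRelativeDimension 1)
    (IsPullback.of_hasPullback f p) h

lemma proper_snd {X S T : Scheme.{u}} (f : X ⟶ S) (p : T ⟶ S)
    (h : IsProper f) : IsProper (pullback.snd f p) :=
  MorphismProperty.of_isPullback (P := @IsProper) (IsPullback.of_hasPullback f p) h

lemma connected_snd {X S T : Scheme.{u}} (f : X ⟶ S) (p : T ⟶ S)
    (h : GeometricallyConnected f) : GeometricallyConnected (pullback.snd f p) :=
  MorphismProperty.of_isPullback (P := @GeometricallyConnected) (IsPullback.of_hasPullback f p) h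

/-- The base change of a section. -/
def baseChangeSec {S T : Scheme.{u}} (F : PointedCurve g n S) (p : T ⟶ S) (i : Fin n) :
    T ⟶ pullback F.proj p :=
  pullback.lift (p ≫ F.sec i) (𝟙 T) (by simp [F.sec_proj])

lemma baseChangeSec_fst {S T : Scheme.{u}} (F : PointedCurve g n S) (p : T ⟶ S) (i : Fin n) :
    F.baseChangeSec p i ≫ pullback.fst F.proj p = p ≫ F.sec i :=
  pullback.lift_fst _ _ _

lemma baseChangeSec_snd {S T : Scheme.{u}} (F : PointedCurve g n S) (p : T ⟶ S) (i : Fin n) :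
    F.baseChangeSec p i ≫ pullback.snd F.proj p = 𝟙 T :=
  pullback.lift_snd _ _ _

lemma baseChangeSec_disjoint {S T : Scheme.{u}} (F : PointedCurve g n S) (p : T ⟶ S)
    (i j : Fin n) (hij : i ≠ j) :
    Disjoint (Set.range (F.baseChangeSec p i)) (Set.range (F.baseChangeSec p j)) := by
  rw [Set.disjoint_left]
  rintro _ ⟨t, rfl⟩ ⟨t', ht'⟩
  have h := congrArg (pullback.fst F.proj p) ht'
  rw [← Scheme.Hom.comp_apply, ← Scheme.Hom.comp_apply, baseChangeSec_fst,
    baseChangeSec_fst, Scheme.Hom.comp_apply, Scheme.Hom.comp_apply] at h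
  exact Set.disjoint_left.mp (F.disjoint i j hij) ⟨p t, rfl⟩ ⟨p t', h⟩

/-- The base change of a family along a morphism `p : T ⟶ S`. -/
def baseChange {S T : Scheme.{u}} (F : PointedCurve g n S) (p : T ⟶ S) :
    PointedCurve g n T where
  total := pullback F.proj p
  proj := pullback.snd F.proj p
  sec := F.baseChangeSec p
  sec_proj := F.baseChangeSec_snd p
  proper := proper_snd _ _ F.proper
  smooth := smooth_snd _ _ F.smooth
  connected := connected_snd _ _ F.connected
  genus Ω _ _ s Z a b h :=
    F.genus Ω (s ≫ p) Z (a ≫ pullback.fst F.proj p) b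
      (h.flip.paste_vert (IsPullback.of_hasPullback F.proj p).flip).flip
  disjoint := F.baseChangeSec_disjoint p

/-- The morphism between the total spaces of two base changes. -/
def baseChangeMap {S T U : Scheme.{u}} (F : PointedCurve g n S) {p : T ⟶ S} {q : U ⟶ S}
    (f : T ⟶ U) (hf : f ≫ q = p) : pullback F.proj p ⟶ pullback F.proj q :=
  pullback.lift (pullback.fst F.proj p) (pullback.snd F.proj p ≫ f)
    (by rw [pullback.condition, Category.assoc, hf])

section

variable {S T U V : Scheme.{u}} (F : PointedCurve g n S) {p : T ⟶ S} {q : U ⟶ S} {r : V ⟶ S}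

lemma baseChangeMap_fst (f : T ⟶ U) (hf : f ≫ q = p) :
    F.baseChangeMap f hf ≫ pullback.fst F.proj q = pullback.fst F.proj p :=
  pullback.lift_fst _ _ _

lemma baseChangeMap_snd (f : T ⟶ U) (hf : f ≫ q = p) :
    F.baseChangeMap f hf ≫ pullback.snd F.proj q = pullback.snd F.proj p ≫ f :=
  pullback.lift_snd _ _ _

lemma baseChangeMap_isPullback (f : T ⟶ U) (hf : f ≫ q = p) :
    IsPullback (F.baseChangeMap f hf) (pullback.snd F.proj p) (pullback.snd F.proj q) f := by
  refine IsPullback.of_right ?_ (F.baseChangeMap_snd f hf) (IsPullback.of_hasPullback F.proj q)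
  rw [baseChangeMap_fst, hf]
  exact IsPullback.of_hasPullback F.proj p

lemma baseChangeMap_sec (f : T ⟶ U) (hf : f ≫ q = p) (i : Fin n) :
    F.baseChangeSec p i ≫ F.baseChangeMap f hf = f ≫ F.baseChangeSec q i := by
  apply pullback.hom_ext
  · rw [Category.assoc, baseChangeMap_fst, baseChangeSec_fst, Category.assoc,
      baseChangeSec_fst, ← Category.assoc, hf]
  · rw [Category.assoc, baseChangeMap_snd, ← Category.assoc, baseChangeSec_snd,
      Category.assoc, baseChangeSec_snd, Category.id_comp, Category.comp_id]

lemma baseChangeMap_id (f : T ⟶ T) (h1 : f = 𝟙 T) (hf : f ≫ p = p) :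
    F.baseChangeMap f hf = 𝟙 (pullback F.proj p) := by
  apply pullback.hom_ext
  · rw [baseChangeMap_fst, Category.id_comp]
  · rw [baseChangeMap_snd, h1, Category.id_comp, Category.comp_id]

lemma baseChangeMap_comp (f : T ⟶ U) (h : U ⟶ V) (k : T ⟶ V) (h1 : k = f ≫ h)
    (hf : f ≫ q = p) (hh : h ≫ r = q) (hk : k ≫ r = p) :
    F.baseChangeMap k hk = F.baseChangeMap f hf ≫ F.baseChangeMap h hh := by
  apply pullback.hom_ext
  · rw [baseChangeMap_fst, Category.assoc, baseChangeMap_fst, baseChangeMap_fst]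
  · rw [baseChangeMap_snd, Category.assoc, baseChangeMap_snd, ← Category.assoc,
      baseChangeMap_snd, Category.assoc, h1]

end

/-- Dropping the last marked point. -/
def dropLast {S : Scheme.{u}} (F : PointedCurve g (n + 1) S) : PointedCurve g n S where
  total := F.total
  proj := F.proj
  sec i := F.sec i.castSucc
  sec_proj i := F.sec_proj _
  proper := F.proper
  smooth := F.smooth
  connected := F.connected
  genus := F.genus
  disjoint i j hij := F.disjoint _ _ (by simpa using hij)

end PointedCurve

/-! ### The moduli stack, as a category over the category of `K`-schemes -/

/-- Objects of the moduli stack of smooth `n`-pointed curves of genus `g` over `K`. -/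
structure Moduli (K : Type u) [Field K] (g n : ℕ) where
  /-- the `K`-scheme over which the family lives -/
  base : Over (Spec (.of K))
  /-- the family -/
  family : PointedCurve g n base.left

namespace Moduli

variable {K : Type u} [Field K] {g n : ℕ}

/-- Morphisms of the moduli stack: cartesian squares compatible with the sections. -/
@[ext]
structure Hom (X Y : Moduli K g n) where
  /-- the morphism of base schemes -/
  base : X.base ⟶ Y.base
  /-- the morphism of total spaces -/
  total : X.family.total ⟶ Y.family.total
  isPullback : IsPullback total X.family.proj Y.family.proj base.left
  sec : ∀ i, X.family.sec i ≫ total = base.left ≫ Y.family.sec i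

instance : Category (Moduli K g n) where
  Hom := Hom
  id X :=
    { base := 𝟙 _
      total := 𝟙 _
      isPullback := IsPullback.id_horiz X.family.proj
      sec := by simp }
  comp f h :=
    { base := f.base ≫ h.base
      total := f.total ≫ h.total
      isPullback := f.isPullback.paste_horiz h.isPullback
      sec := fun i => by
        rw [← Category.assoc, f.sec, Category.assoc, h.sec, Over.comp_left, Category.assoc] }
  id_comp f := Hom.ext (Category.id_comp _) (Category.id_comp _)
  comp_id f := Hom.ext (Category.comp_id _) (Category.comp_id _)
  assoc f h k := Hom.ext (Category.assoc _ _ _) (Category.assoc _ _ _)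

variable (K g n) in
/-- The projection of the moduli stack to the category of `K`-schemes. -/
def toBase : Moduli K g n ⥤ Over (Spec (.of K)) where
  obj X := X.base
  map f := f.base

end Moduli

/-- The moduli stack `M_{g,n}` over `K`, a category over the category of `K`-schemes. -/
def moduliStack (K : Type u) [Field K] (g n : ℕ) :
    BasedCategory.{u, u + 1} (Over (Spec (.of K))) :=
  BasedCategory.ofFunctor (Moduli.toBase K g n)

/-- The stack represented by a `K`-scheme `S`: the category of schemes over `S`. -/
def schemeStack {K : Type u} [Field K] (S : Over (Spec (.of K))) :
    BasedCategory.{u, u + 1} (Over (Spec (.of K))) :=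
  BasedCategory.ofFunctor (Over.forget S)

/-- The morphism of stacks induced by a morphism of `K`-schemes. -/
def schemeStackMap {K : Type u} [Field K] {S T : Over (Spec (.of K))} (p : T ⟶ S) :
    BasedFunctor (schemeStack T) (schemeStack S) where
  toFunctor := Over.map p
  w := rfl

/-- The morphism `M_{g,n+1} ⟶ M_{g,n}` that drops the last marked point. -/
def forgetPoint (K : Type u) [Field K] (g n : ℕ) :
    BasedFunctor (moduliStack K g (n + 1)) (moduliStack K g n) where
  toFunctor :=
    { obj := fun (X : Moduli K g (n + 1)) => (⟨X.base, X.family.dropLast⟩ : Moduli K g n)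
      map := fun {X Y : Moduli K g (n + 1)} (f : Moduli.Hom X Y) =>
        (⟨f.base, f.total, f.isPullback, fun i => f.sec i.castSucc⟩ :
          Moduli.Hom ⟨X.base, X.family.dropLast⟩ ⟨Y.base, Y.family.dropLast⟩)
      map_id := fun _ => rfl
      map_comp := fun _ _ => rfl }
  w := rfl

lemma over_left_w {K : Type u} [Field K] {S : Over (Spec (.of K))} {T U : Over S} (f : T ⟶ U) :
    f.left.left ≫ U.hom.left = T.hom.left := by
  rw [← Over.comp_left, Over.w]

/-- The morphism `S ⟶ M_{g,n}` that corresponds to a family over `S`: it sends an `S`-scheme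
`T` to the base change of the family to `T`. -/
def PointedCurve.classifyingMap {K : Type u} [Field K] {g n : ℕ} {S : Over (Spec (.of K))}
    (F : PointedCurve g n S.left) : BasedFunctor (schemeStack S) (moduliStack K g n) where
  toFunctor :=
    { obj := fun (T : Over S) => (⟨T.left, F.baseChange T.hom.left⟩ : Moduli K g n)
      map := fun {T U : Over S} (f : T ⟶ U) =>
        ({  base := f.left
            total := F.baseChangeMap f.left.left (over_left_w f)
            isPullback := F.baseChangeMap_isPullback _ _
            sec := F.baseChangeMap_sec _ _ } :
          Moduli.Hom (⟨T.left, F.baseChange T.hom.left⟩ : Moduli K g n)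
            ⟨U.left, F.baseChange U.hom.left⟩)
      map_id := fun (_ : Over S) => Moduli.Hom.ext rfl (F.baseChangeMap_id _ rfl (Category.id_comp _))
      map_comp := fun {T U V : Over S} (f : T ⟶ U) (h : U ⟶ V) => Moduli.Hom.ext rfl
        (F.baseChangeMap_comp _ _ _ rfl (over_left_w f) (over_left_w h)
          (over_left_w (f ≫ h))) }
  w := rfl

/-! ### Lifting and codimension -/

/-- `u : S ⟶ M_{g,n}` lifts after base change along `p : T ⟶ S`: there is
`u' : T ⟶ M_{g,n+1}` such that the square formed by `u'`, `p`, `u` and the morphism that drops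
the last point commutes up to an isomorphism of morphisms of stacks. -/
def LiftsAlong {K : Type u} [Field K] {g n : ℕ} {S T : Over (Spec (.of K))}
    (u : BasedFunctor (schemeStack S) (moduliStack K g n)) (p : T ⟶ S) : Prop :=
  ∃ u' : BasedFunctor (schemeStack T) (moduliStack K g (n + 1)),
    Nonempty (u'.comp (forgetPoint K g n) ≅ (schemeStackMap p).comp u)

/-- The codimension of a closed subset `Z` of a scheme: the infimum of the codimensions of the
closures of its points; it is `⊤` for the empty set. -/
def codim {X : Scheme.{u}} (Z : Set X) : ℕ∞ := ⨅ z ∈ Z, Order.coheight z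

end PointedCurves

end

/-! By the 2-Yoneda principle, a lift of `u ∘ p` to `M_{g,n+1}` amounts to a section of the
base-changed curve off the marked points, that is, to a morphism `q : S' ⟶ C` over `S` whose image
avoids them (`liftsAlong_classifyingMap_iff`, `exists_section_baseChange_iff`). The theorem then
concerns closed subsets of `C` off the marked sections.

If `p` is proper and surjective, the image of `q` is closed, surjects onto `S` and avoids the
sections, which forces codimension one (`codim_eq_one`). Conversely, let `T` be closed of
codimension one and off the sections. As `n ≥ 1`, it contains no fiber, so it meets each fiber in a
finite set; being proper and quasi-finite over `S`, it is finite. Flatness puts a codimension-one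
point of `T` over the generic point of `S`, so `T ⟶ S` is surjective
(`isFinite_and_surjective_of_codim_eq_one`). Then `S' = T`, with `q` the inclusion, is the finite
cover sought.

The one-dimensionality of the fibers enters in a single form: a point of a fiber has at most one
proper generization. Distinct components therefore cannot meet, so connected fibers are irreducible,
and their proper closed subsets are finite. The property comes from étale coordinates to the affine
line, over which local rings have principal maximal ideals. -/

/-! ### Primes in unramified algebras over principal ideal rings -/

/-- A prime ideal of a Noetherian local ring with principal maximal ideal is either zero or
maximal. -/
lemma Ideal.IsPrime.eq_bot_or_eq_maximalIdeal {R : Type*} [CommRing R] [IsLocalRing R]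
    [IsNoetherianRing R] (h : (IsLocalRing.maximalIdeal R).IsPrincipal) {p : Ideal R}
    (hp : p.IsPrime) : p = ⊥ ∨ p = IsLocalRing.maximalIdeal R := by
  obtain ⟨a, ha⟩ := h
  by_cases hap : a ∈ p
  · right
    refine le_antisymm (IsLocalRing.le_maximalIdeal hp.ne_top) ?_
    rw [ha, Ideal.submodule_span_eq, Ideal.span_singleton_le_iff_mem]
    exact hap
  · left
    -- If the generator `a` lies outside `p`, then `y * a ∈ p` forces `y ∈ p`. Hence `p = m p`, and
    -- Nakayama gives `p = 0`.
    have hle : p ≤ IsLocalRing.maximalIdeal R • p := by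
      intro x hx
      have hx' := IsLocalRing.le_maximalIdeal hp.ne_top hx
      rw [ha, Ideal.submodule_span_eq, Ideal.mem_span_singleton'] at hx'
      obtain ⟨y, rfl⟩ := hx'
      rw [mul_comm, smul_eq_mul]
      refine Ideal.mul_mem_mul ?_ ((hp.mem_or_mem hx).resolve_right hap)
      rw [ha]
      exact Submodule.mem_span_singleton_self a
    exact Submodule.eq_bot_of_le_smul_of_le_jacobson_bot _ p (IsNoetherian.noetherian p) hle
      (IsLocalRing.maximalIdeal_le_jacobson _)

/-- In an algebra unramified and of finite type over a principal ideal ring, there is at most one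
prime strictly contained in a given prime. -/
lemma Ideal.IsPrime.eq_of_lt_of_lt_of_unramified {P A : Type*} [CommRing P] [IsPrincipalIdealRing P]
    [CommRing A] [Algebra P A] [Algebra.FiniteType P A] [Algebra.FormallyUnramified P A]
    {q q₁ q₂ : Ideal A} (hq : q.IsPrime) (h₁ : q₁.IsPrime) (h₂ : q₂.IsPrime)
    (hlt₁ : q₁ < q) (hlt₂ : q₂ < q) : q₁ = q₂ := by
  let p := q.under P
  let := Localization.AtPrime.algebraOfLiesOver p q
  have : IsNoetherianRing A := Algebra.FiniteType.isNoetherianRing P A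
  have : IsNoetherianRing (Localization.AtPrime q) :=
    IsLocalization.isNoetherianRing q.primeCompl _ inferInstance
  have : Algebra.FormallyUnramified P (Localization.AtPrime q) :=
    .comp P A _
  have : Algebra.FormallyUnramified (Localization.AtPrime p) (Localization.AtPrime q) :=
    .of_restrictScalars P _ _
  have : Algebra.EssFiniteType P (Localization.AtPrime q) := .comp P A _
  have : Algebra.EssFiniteType (Localization.AtPrime p) (Localization.AtPrime q) :=
    .of_comp P _ _
  -- Unramifiedness says that the maximal ideal of `A_q` is generated by that of `P_p`, which is
  -- principal.
  have hm : (IsLocalRing.maximalIdeal (Localization.AtPrime q)).IsPrincipal := by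
    rw [← Algebra.FormallyUnramified.map_maximalIdeal (R := Localization.AtPrime p),
      ← Localization.AtPrime.map_eq_maximalIdeal, Ideal.map_map]
    exact (IsPrincipalIdealRing.principal p).map_ringHom _
  -- A prime strictly below `q` does not become maximal in `A_q`, so it becomes zero there; it is
  -- thus determined as a contraction.
  have key : ∀ r : Ideal A, r.IsPrime → r < q →
      r = (⊥ : Ideal (Localization.AtPrime q)).comap (algebraMap A _) := by
    intro r hr hlt
    have hd : Disjoint (q.primeCompl : Set A) (r : Set A) :=
      Set.disjoint_left.mpr fun x hx hx' => hx (hlt.le hx')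
    have hr' := IsLocalization.isPrime_of_isPrime_disjoint q.primeCompl (Localization.AtPrime q) r hr hd
    have hc := IsLocalization.under_map_of_isPrime_disjoint q.primeCompl
      (Localization.AtPrime q) hr hd
    rcases hr'.eq_bot_or_eq_maximalIdeal hm with h | h
    · rw [← h]; exact hc.symm
    · rw [h] at hc
      exact absurd (hc.symm.trans (Localization.AtPrime.under_maximalIdeal (I := q))) hlt.ne
  rw [key q₁ h₁ hlt₁, key q₂ h₂ hlt₂]

/-! ### Noetherian spaces with unique proper generizations -/

/-- A connected Noetherian sober space in which a point has at most one proper generization is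
irreducible. -/
lemma irreducibleSpace_of_unique_generization {X : Type*} [TopologicalSpace X] [NoetherianSpace X]
    [QuasiSober X] [T0Space X] [ConnectedSpace X]
    (H : ∀ x y z : X, x ⤳ z → y ⤳ z → x ≠ z → y ≠ z → x = y) : IrreducibleSpace X := by
  obtain ⟨x₀⟩ := (inferInstance : Nonempty X)
  let W := irreducibleComponent x₀
  have hW : W ∈ irreducibleComponents X := irreducibleComponent_mem_irreducibleComponents x₀
  let V : Set X := ⋃₀ (irreducibleComponents X \ {W})
  have hV : IsClosed V := by
    rw [show V = _ from Set.sUnion_eq_biUnion]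
    exact NoetherianSpace.finite_irreducibleComponents.sdiff.isClosed_biUnion
      fun W hW => isClosed_of_mem_irreducibleComponents W hW.1
  -- A point in two components would be a specialization of both generic points. These coincide, or
  -- one of them is the point itself; either way one component contains the other, against
  -- maximality.
  have hWV : V = Wᶜ := by
    ext z
    constructor
    · rintro ⟨W', ⟨hW', hne⟩, hz'⟩ hz
      obtain ⟨x, hx⟩ := QuasiSober.sober hW.1 (isClosed_of_mem_irreducibleComponents W hW)
      obtain ⟨y, hy⟩ := QuasiSober.sober hW'.1 (isClosed_of_mem_irreducibleComponents W' hW')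
      have hxz : x ⤳ z := hx.specializes hz
      have hyz : y ⤳ z := hy.specializes hz'
      have hsub : ∀ {A B : Set X} {a b : X}, A ∈ irreducibleComponents X →
          B ∈ irreducibleComponents X → IsGenericPoint a A → IsGenericPoint b B → a ⤳ b →
          A = B := by
        intro A B a b hA hB ha hb hab
        refine (hB.2 hA.1 ?_).antisymm ?_ <;>
        · rw [← ha.def, ← hb.def]
          exact (specializes_iff_closure_subset.mp hab)
      apply hne
      by_cases h1 : x = z
      · exact hsub hW' hW hy hx (h1 ▸ hyz)
      by_cases h2 : y = z
      · exact (hsub hW hW' hx hy (h2 ▸ hxz)).symm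
      · have := H x y z hxz hyz h1 h2
        exact hsub hW' hW hy hx (this ▸ specializes_rfl)
    · intro hz
      refine ⟨irreducibleComponent z, ⟨irreducibleComponent_mem_irreducibleComponents z, ?_⟩,
        mem_irreducibleComponent⟩
      intro h
      exact hz (h ▸ mem_irreducibleComponent)
  have hopen : IsOpen W := by
    rw [← isClosed_compl_iff, ← hWV]; exact hV
  have huniv : W = Set.univ :=
    IsClopen.eq_univ ⟨isClosed_of_mem_irreducibleComponents W hW, hopen⟩
      ⟨x₀, mem_irreducibleComponent⟩
  have : IsIrreducible (Set.univ : Set X) := huniv ▸ hW.1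
  exact { toPreirreducibleSpace := ⟨this.2⟩, toNonempty := ⟨x₀⟩ }

/-- If points of an irreducible Noetherian sober space have at most one proper generization, then
proper closed subsets are finite. -/
lemma IsClosed.finite_of_unique_generization {X : Type*} [TopologicalSpace X] [NoetherianSpace X]
    [QuasiSober X] [T0Space X] [IrreducibleSpace X]
    (H : ∀ x y z : X, x ⤳ z → y ⤳ z → x ≠ z → y ≠ z → x = y) {Z : Set X} (hZ : IsClosed Z)
    (hne : Z ≠ Set.univ) : Z.Finite := by
  have hξ : genericPoint X ∉ Z := by
    intro h
    apply hne
    rw [← Set.univ_subset_iff, ← genericPoint_closure (α := X)]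
    exact closure_minimal (Set.singleton_subset_iff.mpr h) hZ
  obtain ⟨s, hs, hs', hs'', rfl⟩ := NoetherianSpace.exists_finite_set_isClosed_irreducible hZ
  refine hs.sUnion fun W hW => ?_
  obtain ⟨y, hy⟩ := QuasiSober.sober (hs'' W hW) (hs' W hW)
  -- Each irreducible piece is just its generic point `y`: any other `z` in it would have both `y`
  -- and the generic point of `X` as proper generizations.
  refine (Set.finite_singleton y).subset fun z hz => ?_
  by_contra hzy
  have h1 : genericPoint X ≠ z := fun h => hξ (h ▸ ⟨W, hW, hz⟩)
  have := H _ y z (genericPoint_specializes z) (hy.specializes hz) h1 (Ne.symm hzy)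
  exact hξ (this ▸ ⟨W, hW, hy.mem⟩)

/-! ### Fibers of smooth morphisms of relative dimension one -/

namespace AlgebraicGeometry

/-- On a smooth curve over a field, a point has at most one proper generization. -/
lemma SmoothOfRelativeDimension.eq_of_specializes_of_isField {k : CommRingCat.{u}} (hk : IsField k)
    {X : Scheme.{u}} (f : X ⟶ Spec k) (hf : SmoothOfRelativeDimension 1 f) (x y z : X)
    (hxz : x ⤳ z) (hyz : y ⤳ z) (hx : x ≠ z) (hy : y ≠ z) : x = y := by
  let := hk.toField
  obtain ⟨U, hU, V, hV, hzV, e, he⟩ := hf.exists_isStandardSmoothOfRelativeDimension z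
  -- `Spec k` is a single point, so the affine chart downstairs is everything and its ring of
  -- functions is again a field.
  have hUtop : U = ⊤ := by
    ext s
    have : s = f z := Subsingleton.elim (α := PrimeSpectrum k) _ _
    simp only [this, Opens.coe_top, Set.mem_univ, iff_true]
    exact e hzV
  subst hUtop
  have hF : IsField Γ(Spec k, ⊤) :=
    (Scheme.ΓSpecIso k).commRingCatIsoToRingEquiv.isField hk
  let := hF.toField
  -- Étale coordinates in one variable: the chart is étale over a polynomial ring `k[t]`, a
  -- principal ideal ring.
  obtain ⟨g, -, hg⟩ := he.exists_etale_mvPolynomial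
  have : IsPrincipalIdealRing (MvPolynomial (Fin 1) Γ(Spec k, ⊤)) :=
    IsPrincipalIdealRing.of_surjective
      (MvPolynomial.uniqueAlgEquiv Γ(Spec k, ⊤) (Fin 1)).symm.toRingEquiv.toRingHom
      (MvPolynomial.uniqueAlgEquiv Γ(Spec k, ⊤) (Fin 1)).symm.surjective
  algebraize [g]
  have hxV : x ∈ V := hxz.mem_open V.2 hzV
  have hyV : y ∈ V := hyz.mem_open V.2 hzV
  have hpt (a : X) (ha : a ∈ V) : hV.fromSpec (hV.primeIdealOf ⟨a, ha⟩) = a :=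
    hV.fromSpec_primeIdealOf ⟨a, ha⟩
  have hlt (a : X) (ha : a ∈ V) (haz : a ⤳ z) (hne : a ≠ z) :
      (hV.primeIdealOf ⟨a, ha⟩).asIdeal < (hV.primeIdealOf ⟨z, hzV⟩).asIdeal := by
    refine lt_of_le_of_ne ?_ ?_
    · have h : hV.primeIdealOf ⟨a, ha⟩ ⤳ hV.primeIdealOf ⟨z, hzV⟩ := by
        refine hV.fromSpec.isOpenEmbedding.isInducing.specializes_iff.mp ?_
        rw [hpt, hpt]
        exact haz
      exact (PrimeSpectrum.le_iff_specializes _ _).mpr h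
    · intro h
      apply hne
      rw [← hpt a ha, ← hpt z hzV, PrimeSpectrum.ext h]
  have := Ideal.IsPrime.eq_of_lt_of_lt_of_unramified (P := MvPolynomial (Fin 1) Γ(Spec k, ⊤))
    (hV.primeIdealOf ⟨z, hzV⟩).2 (hV.primeIdealOf ⟨x, hxV⟩).2 (hV.primeIdealOf ⟨y, hyV⟩).2
    (hlt x hxV hxz hx) (hlt y hyV hyz hy)
  rw [← hpt x hxV, ← hpt y hyV, PrimeSpectrum.ext this]

section

variable {X Y : Scheme.{u}} (f : X ⟶ Y)

lemma SmoothOfRelativeDimension.fiber_eq_of_specializes (hf : SmoothOfRelativeDimension 1 f)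
    (s : Y) (x y z : f.fiber s) (hxz : x ⤳ z) (hyz : y ⤳ z) (hx : x ≠ z) (hy : y ≠ z) :
    x = y := by
  have : SmoothOfRelativeDimension 1 (f.fiberToSpecResidueField s) :=
    haveI := smoothOfRelativeDimension_isStableUnderBaseChange.{u} 1
    MorphismProperty.of_isPullback (P := @SmoothOfRelativeDimension 1)
      (IsPullback.of_hasPullback f (Y.fromSpecResidueField s)) hf
  exact SmoothOfRelativeDimension.eq_of_specializes_of_isField
    (Field.toIsField (Y.residueField s)) (f.fiberToSpecResidueField s) this x y z hxz hyz hx hy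

/-- In a fiber of a smooth morphism of relative dimension one, a point has at most one proper
generization. -/
lemma SmoothOfRelativeDimension.eq_of_specializes (hf : SmoothOfRelativeDimension 1 f)
    {x y z : X} (hxz : x ⤳ z) (hyz : y ⤳ z) (hx : x ≠ z) (hy : y ≠ z) (hfx : f x = f z)
    (hfy : f y = f z) : x = y := by
  have h := SmoothOfRelativeDimension.fiber_eq_of_specializes f hf (f z)
    ((f.fiberHomeo (f z)).symm ⟨x, hfx⟩) ((f.fiberHomeo (f z)).symm ⟨y, hfy⟩)
    ((f.fiberHomeo (f z)).symm ⟨z, rfl⟩)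
    ((Topology.IsInducing.subtypeVal.specializes_iff.mp hxz).map (f.fiberHomeo (f z)).symm.continuous)
    ((Topology.IsInducing.subtypeVal.specializes_iff.mp hyz).map (f.fiberHomeo (f z)).symm.continuous)
    (fun h => hx (congrArg Subtype.val ((f.fiberHomeo (f z)).symm.injective h)))
    (fun h => hy (congrArg Subtype.val ((f.fiberHomeo (f z)).symm.injective h)))
  exact congrArg Subtype.val ((f.fiberHomeo (f z)).symm.injective h)

variable [QuasiCompact f]

lemma SmoothOfRelativeDimension.noetherianSpace_fiber (hf : SmoothOfRelativeDimension 1 f)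
    (s : Y) : NoetherianSpace (f.fiber s) := by
  have := hf.smooth
  have : LocallyOfFiniteType (f.fiberToSpecResidueField s) :=
    MorphismProperty.of_isPullback (P := @LocallyOfFiniteType)
      (IsPullback.of_hasPullback f (Y.fromSpecResidueField s)) inferInstance
  have : IsLocallyNoetherian (f.fiber s) :=
    LocallyOfFiniteType.isLocallyNoetherian (f.fiberToSpecResidueField s)
  have : IsNoetherian (f.fiber s) := {}
  infer_instance

lemma SmoothOfRelativeDimension.irreducibleSpace_fiber (hf : SmoothOfRelativeDimension 1 f)
    [GeometricallyConnected f] (s : Y) : IrreducibleSpace (f.fiber s) :=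
  haveI := hf.noetherianSpace_fiber f s
  irreducibleSpace_of_unique_generization (hf.fiber_eq_of_specializes f s)

/-- A fiber of a smooth family of connected curves has a generic point. -/
lemma SmoothOfRelativeDimension.exists_generic (hf : SmoothOfRelativeDimension 1 f)
    [GeometricallyConnected f] (s : Y) : ∃ ξ : X, f ξ = s ∧ ∀ x, f x = s → ξ ⤳ x := by
  have := hf.irreducibleSpace_fiber f s
  refine ⟨f.fiberι s (genericPoint (f.fiber s)), ?_, fun x hx => ?_⟩
  · exact (f.range_fiberι s).le ⟨_, rfl⟩
  · obtain ⟨y, rfl⟩ := (f.range_fiberι s).ge hx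
    exact (genericPoint_specializes y).map (f.fiberι s).continuous

/-- A closed subset of a smooth family of connected curves that contains no fiber meets every
fiber in a finite set. -/
lemma SmoothOfRelativeDimension.finite_inter_fiber (hf : SmoothOfRelativeDimension 1 f)
    [GeometricallyConnected f] {Z : Set X} (hZ : IsClosed Z) {s : Y}
    (hs : ∃ x, f x = s ∧ x ∉ Z) : (Z ∩ f ⁻¹' {s}).Finite := by
  have := hf.irreducibleSpace_fiber f s
  have := hf.noetherianSpace_fiber f s
  have h : (f.fiberι s ⁻¹' Z).Finite := by
    refine (hZ.preimage (f.fiberι s).continuous).finite_of_unique_generization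
      (hf.fiber_eq_of_specializes f s) ?_
    obtain ⟨x, hx, hxZ⟩ := hs
    obtain ⟨y, rfl⟩ := (f.range_fiberι s).ge hx
    exact fun h => hxZ (h.ge (Set.mem_univ y))
  rw [← f.range_fiberι s, ← Set.image_preimage_eq_inter_range]
  exact h.image _

end

end AlgebraicGeometry

/-! ### Closed subsets of codimension one in a family -/

namespace PointedCurves

/-- An infimum in the well-ordered `ℕ∞` is attained. -/
lemma exists_mem_codim_eq {X : Scheme.{u}} {Z : Set X} (hZ : Z.Nonempty) :
    ∃ z ∈ Z, Order.coheight z = codim Z := by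
  have := hZ.to_subtype
  obtain ⟨z, hz⟩ := ciInf_mem (fun z : Z => Order.coheight (z : X))
  exact ⟨z, z.2, hz.trans (iInf_subtype' (p := (· ∈ Z)) (f := fun z _ => Order.coheight z)).symm⟩

/-- Generizations are the larger points in the order on a scheme, so `Order.coheight` measures
chains of generizations. -/
lemma lt_of_specializes {X : Scheme.{u}} {x y : X} (h : y ⤳ x) (hne : y ≠ x) : x < y :=
  lt_of_le_not_ge h fun h' => hne (h.antisymm h').eq

namespace PointedCurve

variable {g n : ℕ} {S : Scheme.{u}} (F : PointedCurve g n S)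

lemma proj_sec (i : Fin n) (x : S) : F.proj (F.sec i x) = x := by
  rw [← Scheme.Hom.comp_apply, F.sec_proj]
  rfl

lemma quasiCompact_proj : QuasiCompact F.proj :=
  haveI := F.proper
  inferInstance

/-- A point of codimension one of the total space lies over the generic point of the base if it is
not generic in its fiber. -/
lemma proj_eq_genericPoint_of_coheight_eq_one [IrreducibleSpace S] {z w : F.total}
    (hz : Order.coheight z = 1) (hwz : w ⤳ z) (hne : w ≠ z) (hw : F.proj w = F.proj z) :
    F.proj z = genericPoint S := by
  have := F.smooth.smooth
  by_contra hgen
  -- Going down for the flat map `F.proj` gives `v` over the generic point of `S` that generizes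
  -- `w`. The chain from `z` through `w` to `v` then makes the coheight of `z` at least two.
  obtain ⟨v, hv, hvη⟩ := Flat.generalizingMap F.proj
    ((genericPoint_specializes (F.proj z)).trans (specializes_of_eq hw.symm))
  have hvw : v ≠ w := by
    rintro rfl
    exact hgen (hw.symm.trans hvη)
  have h1 := Order.coheight_add_one_le (lt_of_specializes hv hvw)
  have h2 := Order.coheight_add_one_le (lt_of_specializes hwz hne)
  rw [hz] at h2
  have h3 : (1 : ℕ∞) + 1 ≤ 1 :=
    le_trans (add_le_add_left (le_trans le_add_self h1) 1) h2
  exact absurd h3 (by decide)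

/-- A closed subscheme of codimension one that avoids a section is finite and surjective over the
base. -/
lemma isFinite_and_surjective_of_codim_eq_one [IsIntegral S] {T : Scheme.{u}} (i : T ⟶ F.total)
    [IsClosedImmersion i] (hcodim : codim (Set.range i) = 1) (j : Fin n)
    (hj : Disjoint (Set.range i) (Set.range (F.sec j))) :
    IsFinite (i ≫ F.proj) ∧ Surjective (i ≫ F.proj) := by
  have := F.proper
  have := F.connected
  have hclosed : IsClosed (Set.range i) := i.isClosedEmbedding.isClosed_range
  have hnot (x : S) : F.sec j x ∉ Set.range i := fun h =>
    Set.disjoint_left.mp hj h ⟨x, rfl⟩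
  constructor
  · have : LocallyQuasiFinite (i ≫ F.proj) := by
      refine .of_finite_preimage_singleton _ fun s => ?_
      have h := F.smooth.finite_inter_fiber F.proj hclosed (s := s)
        ⟨F.sec j s, F.proj_sec j s, hnot s⟩
      refine (h.preimage i.isClosedEmbedding.injective.injOn).subset fun t ht => ⟨⟨t, rfl⟩, ?_⟩
      simpa using ht
    exact IsFinite.of_isProper_of_locallyQuasiFinite _
  -- The empty set has codimension `⊤`, so codimension one gives a point.
  · have hne : (Set.range i).Nonempty := by
      by_contra h
      rw [Set.not_nonempty_iff_eq_empty] at h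
      rw [h] at hcodim
      simp [codim] at hcodim
    obtain ⟨z, ⟨t, rfl⟩, hz⟩ := exists_mem_codim_eq hne
    rw [hcodim] at hz
    obtain ⟨ξ, hξ, hgen⟩ := F.smooth.exists_generic F.proj (F.proj (i t))
    -- If the generic point of the fiber were in the closed set, the whole fiber would be, including
    -- its `j`-th marked point.
    have hξz : ξ ≠ i t := by
      rintro rfl
      exact hnot _ ((hgen _ (F.proj_sec j _)).mem_closed hclosed ⟨t, rfl⟩)
    have hη := F.proj_eq_genericPoint_of_coheight_eq_one hz (hgen _ rfl) hξz hξ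
    refine ⟨fun s => ?_⟩
    have hc : IsClosed (Set.range (i ≫ F.proj)) := (i ≫ F.proj).isClosedMap.isClosed_range
    refine (genericPoint_specializes s).mem_closed hc ⟨t, ?_⟩
    rw [Scheme.Hom.comp_apply, hη]

/-- A closed subset of the total space which surjects onto the base and avoids a section has
codimension one. -/
lemma codim_eq_one [IsIntegral S] {Z : Set F.total} (hZ : IsClosed Z)
    (hsurj : F.proj '' Z = Set.univ) (j : Fin n) (hj : Disjoint Z (Set.range (F.sec j))) :
    codim Z = 1 := by
  have := F.connected
  have := F.smooth.smooth
  have := F.quasiCompact_proj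
  apply le_antisymm
  · obtain ⟨z, hz, hzη⟩ := hsurj.ge (Set.mem_univ (genericPoint S))
    refine (iInf₂_le z hz).trans ?_
    -- Generizations of a point over the generic point of `S` stay in the generic fiber, where
    -- proper generizations are unique; chains above `z` thus have length at most one.
    have hη {w v : F.total} (h : v ⤳ w) (hw : F.proj w = genericPoint S) :
        F.proj v = genericPoint S :=
      ((genericPoint_specializes (F.proj v)).antisymm
        (hw ▸ h.map F.proj.continuous)).eq.symm
    refine (Order.coheight_le_coe_iff (n := 1)).mpr fun w hw => ?_
    have hwz : w ⤳ z := hw.le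
    have hmax : IsMax w := by
      intro v hv
      have hvw : v ⤳ w := hv
      by_cases h : v = w
      · exact h.le
      have hvz : v ≠ z := by
        rintro rfl
        exact hw.not_ge hv
      have hwz' : w ≠ z := fun h => hw.ne h.symm
      exact absurd (F.smooth.eq_of_specializes F.proj (hvw.trans hwz) hwz hvz hwz'
        ((hη (hvw.trans hwz) hzη).trans hzη.symm) ((hη hwz hzη).trans hzη.symm)) h
    rw [Order.coheight_eq_zero.mpr hmax]
    exact zero_lt_one
  · refine le_iInf₂ fun z hz => ?_
    rw [Order.one_le_iff_pos, Order.coheight_pos]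
    intro hmax
    obtain ⟨ξ, -, hgen⟩ := F.smooth.exists_generic F.proj (F.proj z)
    -- A maximal `z` would be generic in its fiber, so `Z` would contain that fiber and meet the
    -- section.
    have h : z ⤳ ξ := hmax (hgen z rfl)
    exact Set.disjoint_left.mp hj
      ((h.trans (hgen _ (F.proj_sec j _))).mem_closed hZ hz) ⟨F.proj z, rfl⟩

/-! ### Sections off the marked points and the subschemes they sweep out -/

/-- A point of a base change lies on the base change of a section as soon as its image lies on the
section. -/
lemma mem_range_baseChangeSec {T : Scheme.{u}} (p : T ⟶ S) (i : Fin n)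
    {x : ↥(pullback F.proj p)}
    (hx : pullback.fst F.proj p x ∈ Set.range (F.sec i)) :
    x ∈ Set.range (F.baseChangeSec p i) := by
  -- Points of a fiber product are not determined by their projections; the preimage is found by
  -- exhibiting the new section as the base change of the old one.
  have h : IsPullback (F.baseChangeSec p i) p (pullback.fst F.proj p) (F.sec i) := by
    refine IsPullback.of_right ?_ (F.baseChangeSec_fst p i)
      (IsPullback.of_hasPullback F.proj p).flip
    rw [F.sec_proj, F.baseChangeSec_snd]
    exact IsPullback.id_horiz p
  obtain ⟨y, hy⟩ := hx
  obtain ⟨t, ht, -⟩ := Scheme.exists_preimage_of_isPullback h x y hy.symm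
  exact ⟨t, ht⟩

lemma disjoint_range_lift {T : Scheme.{u}} (p : T ⟶ S) (q : T ⟶ F.total) (hq : q ≫ F.proj = p)
    (hd : ∀ j, Disjoint (Set.range q) (Set.range (F.sec j))) (j : Fin n) :
    Disjoint
      (Set.range (pullback.lift q (𝟙 T) (by rw [hq, Category.id_comp]) : T ⟶ pullback F.proj p))
      (Set.range (F.baseChangeSec p j)) := by
  rw [Set.disjoint_left]
  rintro _ ⟨t, rfl⟩ ⟨t', h⟩
  have h' := congrArg (pullback.fst F.proj p) h
  rw [← Scheme.Hom.comp_apply, ← Scheme.Hom.comp_apply, baseChangeSec_fst, pullback.lift_fst,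
    Scheme.Hom.comp_apply] at h'
  exact Set.disjoint_left.mp (hd j) ⟨t, rfl⟩ ⟨p t', h'⟩

/-- Sections of a base change that avoid the marked points are the same as lifts to the total space
that avoid the marked points. -/
lemma exists_section_baseChange_iff {T : Scheme.{u}} (p : T ⟶ S) :
    (∃ s : T ⟶ (F.baseChange p).total, s ≫ (F.baseChange p).proj = 𝟙 T ∧
      ∀ j, Disjoint (Set.range s) (Set.range ((F.baseChange p).sec j))) ↔
    ∃ q : T ⟶ F.total, q ≫ F.proj = p ∧
      ∀ j, Disjoint (Set.range q) (Set.range (F.sec j)) := by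
  constructor
  · rintro ⟨s, hs, hd⟩
    refine ⟨(show T ⟶ pullback F.proj p from s) ≫ pullback.fst F.proj p, ?_, fun j => ?_⟩
    · rw [Category.assoc, pullback.condition, ← Category.assoc]
      exact (congrArg (· ≫ p) hs).trans (Category.id_comp p)
    · rw [Set.disjoint_left]
      rintro _ ⟨t, rfl⟩ h
      refine Set.disjoint_left.mp (hd j) ⟨t, rfl⟩ (F.mem_range_baseChangeSec p j ?_)
      rwa [Scheme.Hom.comp_apply] at h
  · rintro ⟨q, hq, hd⟩
    exact ⟨pullback.lift q (𝟙 T) (by simp [hq]), pullback.lift_snd _ _ _,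
      F.disjoint_range_lift p q hq hd⟩

/-- A proper cover of the base with a lift to the total space that avoids the marked points sweeps
out a closed subscheme of codimension one. -/
lemma exists_closed_codim_eq_one [IsIntegral S] (hn : 1 ≤ n) {T : Scheme.{u}} (p : T ⟶ S)
    [IsProper p] [Surjective p] (q : T ⟶ F.total) (hq : q ≫ F.proj = p)
    (hd : ∀ j, Disjoint (Set.range q) (Set.range (F.sec j))) :
    ∃ (Z : Scheme.{u}) (i : Z ⟶ F.total), IsClosedImmersion i ∧ codim (Set.range i) = 1 ∧
      ∀ j, Disjoint (Set.range i) (Set.range (F.sec j)) := by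
  have := F.proper
  have : IsProper (q ≫ F.proj) := hq ▸ inferInstance
  -- `q` is proper because its composite with the separated `F.proj` is; its image is therefore
  -- closed and carries the reduced structure.
  have : IsProper q := .of_comp q F.proj
  have hclosed : IsClosed (Set.range q) := q.isClosedMap.isClosed_range
  let I := Scheme.IdealSheafData.vanishingIdeal ⟨Set.range q, hclosed⟩
  have hI : Set.range I.subschemeι = Set.range q := by
    rw [I.range_subschemeι, Scheme.IdealSheafData.coe_support_vanishingIdeal]
    rfl
  refine ⟨I.subscheme, I.subschemeι, inferInstance, ?_, hI ▸ hd⟩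
  rw [hI]
  refine F.codim_eq_one hclosed ?_ ⟨0, hn⟩ (hd _)
  rw [← Set.range_comp, Set.range_eq_univ]
  intro x
  obtain ⟨t, ht⟩ := p.surjective x
  refine ⟨t, ?_⟩
  rw [Function.comp_apply, ← Scheme.Hom.comp_apply, hq, ht]

end PointedCurve

end PointedCurves

/-! ### Lifts to the moduli stack with one more point -/

noncomputable section

namespace PointedCurves

namespace PointedCurve

variable {g n : ℕ} {S : Scheme.{u}} (F : PointedCurve g n S)

/-- The base change of a family along `p` together with the marked point given by a lift of `p` to
the total space. -/
def baseChangeCons {T : Scheme.{u}} (p : T ⟶ S) (q : T ⟶ F.total) (hq : q ≫ F.proj = p)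
    (hd : ∀ j, Disjoint (Set.range q) (Set.range (F.sec j))) : PointedCurve g (n + 1) T where
  total := pullback F.proj p
  proj := pullback.snd F.proj p
  sec := Fin.snoc (α := fun _ => T ⟶ pullback F.proj p) (F.baseChangeSec p)
    (pullback.lift q (𝟙 T) (by rw [hq, Category.id_comp]))
  sec_proj i := by
    refine Fin.lastCases ?_ (fun j => ?_) i
    · rw [Fin.snoc_last, pullback.lift_snd]
    · rw [Fin.snoc_castSucc, baseChangeSec_snd]
  proper := (F.baseChange p).proper
  smooth := (F.baseChange p).smooth
  connected := (F.baseChange p).connected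
  genus := (F.baseChange p).genus
  disjoint i j hij := by
    have key := F.disjoint_range_lift p q hq hd
    induction i using Fin.lastCases with
    | last =>
      induction j using Fin.lastCases with
      | last => exact absurd rfl hij
      | cast j => simpa only [Fin.snoc_last, Fin.snoc_castSucc] using key j
    | cast i =>
      induction j using Fin.lastCases with
      | last => simpa only [Fin.snoc_last, Fin.snoc_castSucc] using (key i).symm
      | cast j =>
        simpa only [Fin.snoc_castSucc] using
          F.baseChangeSec_disjoint p i j fun h => hij (congrArg Fin.castSucc h)

lemma baseChangeCons_sec_castSucc {T : Scheme.{u}} (p : T ⟶ S) (q : T ⟶ F.total)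
    (hq : q ≫ F.proj = p) (hd : ∀ j, Disjoint (Set.range q) (Set.range (F.sec j))) (i : Fin n) :
    (F.baseChangeCons p q hq hd).sec i.castSucc = F.baseChangeSec p i :=
  Fin.snoc_castSucc (α := fun _ => T ⟶ pullback F.proj p) _ _ _

lemma baseChangeCons_sec_last {T : Scheme.{u}} (p : T ⟶ S) (q : T ⟶ F.total)
    (hq : q ≫ F.proj = p) (hd : ∀ j, Disjoint (Set.range q) (Set.range (F.sec j))) :
    (F.baseChangeCons p q hq hd).sec (Fin.last n) =
      pullback.lift q (𝟙 T) (by rw [hq, Category.id_comp]) :=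
  Fin.snoc_last (α := fun _ => T ⟶ pullback F.proj p) _ _

lemma lift_baseChangeMap {T U : Scheme.{u}} {p : T ⟶ S} {r : U ⟶ S} (f : T ⟶ U)
    (hf : f ≫ r = p) (q : T ⟶ F.total) (q' : U ⟶ F.total) (hq : q ≫ F.proj = p)
    (hq' : q' ≫ F.proj = r) (hqq : q = f ≫ q') :
    pullback.lift q (𝟙 T) (by rw [hq, Category.id_comp]) ≫ F.baseChangeMap f hf =
      f ≫ pullback.lift q' (𝟙 U) (by rw [hq', Category.id_comp]) := by
  apply pullback.hom_ext
  · rw [Category.assoc, baseChangeMap_fst, pullback.lift_fst, Category.assoc, pullback.lift_fst,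
      hqq]
  · rw [Category.assoc, baseChangeMap_snd, ← Category.assoc, pullback.lift_snd, Category.assoc,
      pullback.lift_snd, Category.id_comp, Category.comp_id]

/-- This is the compatibility with sections that makes the enlarged families functorial in the base.
-/
lemma baseChangeCons_sec_baseChangeMap {T U : Scheme.{u}} {p : T ⟶ S} {r : U ⟶ S} (f : T ⟶ U)
    (hf : f ≫ r = p) (q : T ⟶ F.total) (q' : U ⟶ F.total) (hq : q ≫ F.proj = p)
    (hq' : q' ≫ F.proj = r) (hd : ∀ j, Disjoint (Set.range q) (Set.range (F.sec j)))
    (hd' : ∀ j, Disjoint (Set.range q') (Set.range (F.sec j))) (hqq : q = f ≫ q')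
    (i : Fin (n + 1)) :
    (F.baseChangeCons p q hq hd).sec i ≫ F.baseChangeMap f hf =
      f ≫ (F.baseChangeCons r q' hq' hd').sec i := by
  induction i using Fin.lastCases with
  | last =>
    rw [baseChangeCons_sec_last, baseChangeCons_sec_last]
    exact F.lift_baseChangeMap f hf q q' hq hq' hqq
  | cast i =>
    rw [baseChangeCons_sec_castSucc, baseChangeCons_sec_castSucc]
    exact F.baseChangeMap_sec f hf i

lemma disjoint_range_comp {T U : Scheme.{u}} (f : T ⟶ U) (q : U ⟶ F.total)
    (hd : ∀ j, Disjoint (Set.range q) (Set.range (F.sec j))) (j : Fin n) :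
    Disjoint (Set.range (f ≫ q)) (Set.range (F.sec j)) :=
  (hd j).mono_left (by rintro _ ⟨t, rfl⟩; exact ⟨f t, (Scheme.Hom.comp_apply f q t).symm⟩)

/-- The last section of a family gives a section that avoids the marked points on every family
isomorphic to the one obtained by dropping this section. -/
lemma exists_section_of_retract {T : Scheme.{u}} (G : PointedCurve g n S)
    (X : PointedCurve g (n + 1) T) (a : X.total ⟶ G.total) (b : G.total ⟶ X.total) (a' : T ⟶ S)
    (b' : S ⟶ T) (hab : a ≫ b = 𝟙 X.total) (hba : b' ≫ a' = 𝟙 S)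
    (w : a ≫ G.proj = X.proj ≫ a') (hsec : ∀ i : Fin n, X.sec i.castSucc ≫ a = a' ≫ G.sec i) :
    ∃ s : S ⟶ G.total, s ≫ G.proj = 𝟙 S ∧
      ∀ j, Disjoint (Set.range s) (Set.range (G.sec j)) := by
  -- The retraction `b` makes `a` injective on points, so disjointness of the sections of `X`
  -- survives transport along `a`.
  have hinj : Function.Injective a := by
    intro x y hxy
    have h := congrArg b hxy
    rwa [← Scheme.Hom.comp_apply, ← Scheme.Hom.comp_apply, hab] at h
  refine ⟨(b' ≫ X.sec (Fin.last n)) ≫ a, ?_, fun j => ?_⟩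
  · rw [Category.assoc, w, Category.assoc, ← Category.assoc (X.sec _), X.sec_proj,
      Category.id_comp, hba]
  · have h : G.sec j = (b' ≫ X.sec j.castSucc) ≫ a := by
      rw [Category.assoc, hsec, ← Category.assoc, hba, Category.id_comp]
    rw [h, Set.disjoint_left]
    rintro _ ⟨t, rfl⟩ ⟨t', ht⟩
    simp only [Scheme.Hom.comp_apply] at ht
    exact Set.disjoint_left.mp (X.disjoint j.castSucc (Fin.last n) j.castSucc_lt_last.ne)
      ⟨_, rfl⟩ ⟨_, (hinj ht).symm⟩

end PointedCurve

section

variable {K : Type u} [Field K] {g n : ℕ} {S T : Over (Spec (.of K))}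
  (F : PointedCurve g n S.left) (p : T ⟶ S)

/-- The pullback to a scheme over `T` of the family with one more marked point that is given by a
lift of `p : T ⟶ S` to the total space. -/
def PointedCurve.liftFamily (q : T.left ⟶ F.total) (hq : q ≫ F.proj = p.left)
    (hd : ∀ j, Disjoint (Set.range q) (Set.range (F.sec j))) (U : Over T) :
    PointedCurve g (n + 1) U.left.left :=
  F.baseChangeCons ((Over.map p).obj U).hom.left (U.hom.left ≫ q)
    ((Category.assoc _ _ _).trans (congrArg (U.hom.left ≫ ·) hq)) (F.disjoint_range_comp _ _ hd)

/-- The morphism to `M_{g,n+1}` given by a lift of `p` to the total space that avoids the marked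
points. -/
def PointedCurve.liftMap (q : T.left ⟶ F.total) (hq : q ≫ F.proj = p.left)
    (hd : ∀ j, Disjoint (Set.range q) (Set.range (F.sec j))) :
    BasedFunctor (schemeStack T) (moduliStack K g (n + 1)) where
  toFunctor :=
    { obj := fun (U : Over T) => (⟨U.left, F.liftFamily p q hq hd U⟩ : Moduli K g (n + 1))
      map := fun {U V : Over T} (f : U ⟶ V) =>
        ({  base := f.left
            total := F.baseChangeMap f.left.left (over_left_w ((Over.map p).map f))
            isPullback := F.baseChangeMap_isPullback _ _
            sec := F.baseChangeCons_sec_baseChangeMap f.left.left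
              (over_left_w ((Over.map p).map f)) (U.hom.left ≫ q) (V.hom.left ≫ q)
              ((Category.assoc _ _ _).trans (congrArg (U.hom.left ≫ ·) hq))
              ((Category.assoc _ _ _).trans (congrArg (V.hom.left ≫ ·) hq))
              (F.disjoint_range_comp _ _ hd) (F.disjoint_range_comp _ _ hd)
              ((congrArg (· ≫ q) (over_left_w f).symm).trans (Category.assoc _ _ _)) } :
          Moduli.Hom (⟨U.left, F.liftFamily p q hq hd U⟩ : Moduli K g (n + 1))
            ⟨V.left, F.liftFamily p q hq hd V⟩)
      map_id := fun (_ : Over T) => Moduli.Hom.ext rfl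
        (F.baseChangeMap_id _ rfl (Category.id_comp _))
      map_comp := fun {U V W : Over T} (f : U ⟶ V) (h : V ⟶ W) => Moduli.Hom.ext rfl
        (F.baseChangeMap_comp _ _ _ rfl (over_left_w ((Over.map p).map f))
          (over_left_w ((Over.map p).map h)) (over_left_w ((Over.map p).map (f ≫ h)))) }
  w := rfl

lemma PointedCurve.liftFamily_sec_castSucc (q : T.left ⟶ F.total) (hq : q ≫ F.proj = p.left)
    (hd : ∀ j, Disjoint (Set.range q) (Set.range (F.sec j))) (U : Over T) (i : Fin n) :
    (F.liftFamily p q hq hd U).sec i.castSucc =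
      F.baseChangeSec ((Over.map p).obj U).hom.left i :=
  F.baseChangeCons_sec_castSucc _ _ _ _ i

/-- Dropping the last point of the family given by a lift recovers the base change. -/
def PointedCurve.liftFamilyIso (q : T.left ⟶ F.total) (hq : q ≫ F.proj = p.left)
    (hd : ∀ j, Disjoint (Set.range q) (Set.range (F.sec j))) (U : Over T) :
    (⟨U.left, (F.liftFamily p q hq hd U).dropLast⟩ : Moduli K g n) ≅
      ⟨U.left, F.baseChange ((Over.map p).obj U).hom.left⟩ where
  -- The underlying curves are the same; only the sections, through `Fin.snoc`, are not
  -- definitionally equal.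
  hom :=
    { base := 𝟙 U.left
      total := 𝟙 (pullback F.proj ((Over.map p).obj U).hom.left)
      isPullback := IsPullback.id_horiz (pullback.snd F.proj ((Over.map p).obj U).hom.left)
      sec := fun i => (Category.comp_id ((F.liftFamily p q hq hd U).sec i.castSucc)).trans
        ((F.liftFamily_sec_castSucc p q hq hd U i).trans
          (Category.id_comp (F.baseChangeSec ((Over.map p).obj U).hom.left i)).symm) }
  inv :=
    { base := 𝟙 U.left
      total := 𝟙 (pullback F.proj ((Over.map p).obj U).hom.left)
      isPullback := IsPullback.id_horiz (pullback.snd F.proj ((Over.map p).obj U).hom.left)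
      sec := fun i => (Category.comp_id (F.baseChangeSec ((Over.map p).obj U).hom.left i)).trans
        ((F.liftFamily_sec_castSucc p q hq hd U i).symm.trans
          (Category.id_comp ((F.liftFamily p q hq hd U).sec i.castSucc)).symm) }
  hom_inv_id := Moduli.Hom.ext (Category.comp_id (𝟙 U.left))
    (Category.comp_id (𝟙 (pullback F.proj ((Over.map p).obj U).hom.left)))
  inv_hom_id := Moduli.Hom.ext (Category.comp_id (𝟙 U.left))
    (Category.comp_id (𝟙 (pullback F.proj ((Over.map p).obj U).hom.left)))

/-- Dropping the last point after the morphism given by a lift recovers the restriction of the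
classifying morphism. -/
def PointedCurve.liftMapIso (q : T.left ⟶ F.total) (hq : q ≫ F.proj = p.left)
    (hd : ∀ j, Disjoint (Set.range q) (Set.range (F.sec j))) :
    (F.liftMap p q hq hd).comp (forgetPoint K g n) ≅ (schemeStackMap p).comp F.classifyingMap :=
  BasedNatIso.mkNatIso
    (NatIso.ofComponents (fun (U : Over T) => F.liftFamilyIso p q hq hd U)
      (fun (f : _ ⟶ (_ : Over T)) => Moduli.Hom.ext
        ((Category.comp_id f.left).trans (Category.id_comp f.left).symm)
        ((Category.comp_id
            (F.baseChangeMap f.left.left (over_left_w ((Over.map p).map f)))).trans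
          (Category.id_comp
            (F.baseChangeMap f.left.left (over_left_w ((Over.map p).map f)))).symm)))
    -- The base components are identities, so the isomorphism is vertical, as a 2-isomorphism of
    -- stacks must be.
    (fun (U : Over T) => IsHomLift.map (Moduli.toBase K g n) (F.liftFamilyIso p q hq hd U).hom)

/-- Evaluating the 2-isomorphism at the universal object `𝟙 T` turns the last section of the family
there into a section of the base change. Conversely, `q` is pulled back to every `T`-scheme. -/
lemma liftsAlong_classifyingMap_iff :
    LiftsAlong F.classifyingMap p ↔ ∃ q : T.left ⟶ F.total, q ≫ F.proj = p.left ∧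
      ∀ j, Disjoint (Set.range q) (Set.range (F.sec j)) := by
  constructor
  · rintro ⟨u', ⟨e⟩⟩
    -- At `𝟙 T` the classifying map base changes along `𝟙 T ≫ p`, so `p` is put in that form.
    rw [show p.left = (𝟙 T ≫ p).left from congrArg _ (Category.id_comp p).symm,
      ← F.exists_section_baseChange_iff]
    let X : Moduli K g (n + 1) := u'.obj (Over.mk (𝟙 T))
    let X' : Moduli K g n := ⟨X.base, X.family.dropLast⟩
    let Y : Moduli K g n := ⟨T, F.baseChange (𝟙 T ≫ p).left⟩
    let a : X' ⟶ Y := e.hom.toNatTrans.app (Over.mk (𝟙 T))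
    let b : Y ⟶ X' := e.inv.toNatTrans.app (Over.mk (𝟙 T))
    have hab : a ≫ b = 𝟙 X' := congrArg (fun α => α.toNatTrans.app (Over.mk (𝟙 T))) e.hom_inv_id
    have hba : b ≫ a = 𝟙 Y := congrArg (fun α => α.toNatTrans.app (Over.mk (𝟙 T))) e.inv_hom_id
    -- Transport along `a.base` and `b.base` avoids identifying `X.base` with `T`.
    exact PointedCurve.exists_section_of_retract (F.baseChange (𝟙 T ≫ p).left) X.family
      a.total b.total a.base.left b.base.left (congrArg Moduli.Hom.total hab)
      (congrArg (fun h : Moduli.Hom Y Y => h.base.left) hba) a.isPullback.w a.sec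
  · rintro ⟨q, hq, hd⟩
    exact ⟨F.liftMap p q hq hd, ⟨F.liftMapIso p q hq hd⟩⟩

end

end PointedCurves

end

/-! ### The cycle of implications -/

open PointedCurves in
theorem mainTheorem11 {K : Type u} [Field K] [IsAlgClosed K] (g n : ℕ) (hn : 1 ≤ n)
    (S : Over (Spec (.of K))) [IsIntegral S.left] [IsSeparated S.hom]
    [LocallyOfFiniteType S.hom] [QuasiCompact S.hom] (F : PointedCurve g n S.left) :
    List.TFAE [
      ∃ (T : Over (Spec (.of K))) (p : T ⟶ S), IsProper p.left ∧ Surjective p.left ∧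
        LiftsAlong F.classifyingMap p,
      ∃ (T : Over (Spec (.of K))) (p : T ⟶ S), IsFinite p.left ∧ Surjective p.left ∧
        LiftsAlong F.classifyingMap p,
      ∃ (T : Scheme.{u}) (i : T ⟶ F.total), IsClosedImmersion i ∧
        codim (Set.range i) = 1 ∧ ∀ j, Disjoint (Set.range i) (Set.range (F.sec j)),
      ∃ (T : Scheme.{u}) (p : T ⟶ S.left), IsProper p ∧ Surjective p ∧
        ∃ s : T ⟶ (F.baseChange p).total, s ≫ (F.baseChange p).proj = 𝟙 T ∧
          ∀ j, Disjoint (Set.range s) (Set.range ((F.baseChange p).sec j))] := by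
  tfae_have 2 → 1 := fun ⟨T, p, _, hs, hl⟩ => ⟨T, p, inferInstance, hs, hl⟩
  tfae_have 1 → 4 := fun ⟨T, p, hp, hs, hl⟩ => ⟨T.left, p.left, hp, hs,
    (F.exists_section_baseChange_iff p.left).mpr ((liftsAlong_classifyingMap_iff F p).mp hl)⟩
  tfae_have 4 → 3 := by
    rintro ⟨T, p, _, _, h⟩
    obtain ⟨q, hq, hd⟩ := (F.exists_section_baseChange_iff p).mp h
    exact F.exists_closed_codim_eq_one hn p q hq hd
  tfae_have 3 → 2 := by
    rintro ⟨T, i, _, hcodim, hd⟩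
    obtain ⟨h1, h2⟩ := F.isFinite_and_surjective_of_codim_eq_one i hcodim ⟨0, hn⟩ (hd _)
    -- The cover is the closed subscheme itself, and its inclusion is the tautological extra point.
    exact ⟨Over.mk ((i ≫ F.proj) ≫ S.hom), Over.homMk (i ≫ F.proj), h1, h2,
      (liftsAlong_classifyingMap_iff F _).mpr ⟨i, rfl, hd⟩⟩
  tfae_finish
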